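/- Let $p\in(0,1)$ and $q=1-p$. For real $r>0$, let $\mathrm{NegBin}(r,p)$ be the probability distribution on $\mathbb{N}_0=\{0,1,2,\dots\}$ with probability mass function $$P_{r,p}(k)=\frac{\Gamma(r+k)}{\Gamma(r)\,k!}\,q^r p^k,\qquad k\in\mathbb{N}_0,$$ and for a real random variable $X$ let $\mathrm{Median}(X)=\inf\{x\in\mathbb{R}:\mathbb{P}(X\le x)\ge \tfrac12\}$. Let $K\sim\mathrm{NegBin}(r,p)$ and $U\sim\mathrm{Uniform}(0,1)$ be independent. Then, as $r\to\infty$ through the reals with $p$ fixed, $$\mathrm{Median}(K+U)-\frac{rp}{q}=\frac12-\frac{1+p}{6q}+\mathcal{O}_p(r^{-1}),$$ that is, there are constants $C_p>0$ and $r_p>0$, depending only on $p$, such that for every real $r\ge r_p$, $$\left|\mathrm{Median}(K+U)-\frac{rp}{q}-\left(\frac12-\frac{1+p}{6q}\right)\right|\le \frac{C_p}{r}.$$ -/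

import Mathlib

/-- The negative binomial probability mass function
`P_{r,p}(k) = Γ(r + k) / (Γ(r) k!) q ^ r p ^ k`, where `q = 1 - p`. -/
noncomputable def negBinPMF (r p : ℝ) (k : ℕ) : ℝ :=
  Real.Gamma (r + k) / (Real.Gamma r * (k.factorial : ℝ)) * (1 - p) ^ r * p ^ k

/-- The law `NegBin(r, p)` as a measure on `ℕ`: mass `P_{r,p}(k)` at each `k`. -/
noncomputable def negBinMeasure (r p : ℝ) : MeasureTheory.Measure ℕ :=
  MeasureTheory.Measure.sum
    (fun k : ℕ => ENNReal.ofReal (negBinPMF r p k) • MeasureTheory.Measure.dirac k)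

/-- The median of a real random variable, `inf {x ∈ ℝ : ℙ(X ≤ x) ≥ 1/2}`. -/
noncomputable def median {Ω : Type*} [MeasurableSpace Ω] (P : MeasureTheory.Measure Ω)
    (X : Ω → ℝ) : ℝ :=
  sInf {x : ℝ | 1 / 2 ≤ P.real {ω | X ω ≤ x}}

theorem gamma_add_nat_div_gamma {r : ℝ} (hr : 0 < r) (k : ℕ) :
    Real.Gamma (r + k) / Real.Gamma r = (ascPochhammer ℝ k).eval r := by
  induction k with
  | zero => simp [(Real.Gamma_pos_of_pos hr).ne']
  | succ k ih =>
    have h : r + k ≠ 0 := by positivity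
    rw [ascPochhammer_succ_eval, ← ih, Nat.cast_succ, ← add_assoc, Real.Gamma_add_one h]
    ring

theorem negBinPMF_nonneg {r p : ℝ} (hr : 0 < r) (hp0 : 0 < p) (hp1 : p < 1) (k : ℕ) :
    0 ≤ negBinPMF r p k := by
  have h1 := Real.Gamma_pos_of_pos hr
  have h2 : 0 < Real.Gamma (r + k) := Real.Gamma_pos_of_pos (by positivity)
  have h3 : 0 < 1 - p := by linarith
  unfold negBinPMF
  positivity

theorem hasSum_negBinPMF {r p : ℝ} (hr : 0 < r) (hp0 : 0 < p) (hp1 : p < 1) :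
    HasSum (negBinPMF r p) 1 := by
  have h3 : 0 < 1 - p := by linarith
  have h := (Real.one_div_one_sub_rpow_hasFPowerSeriesOnBall_zero r).hasSum (y := p)
    (by simp [enorm_eq_nnnorm, ← NNReal.coe_lt_coe, abs_of_pos hp0, hp1])
  have h' := h.mul_left ((1 - p) ^ r)
  have h4 : (1 - p) ^ r ≠ 0 := by positivity
  simp only [zero_add, mul_one_div_cancel h4] at h'
  convert! h' using 1
  funext k
  have hc : (k.factorial : ℝ) * Ring.choose (r + k - 1) k = (ascPochhammer ℝ k).eval r := by
    rw [← Ring.multichoose_eq, ← nsmul_eq_mul, Ring.factorial_nsmul_multichoose_eq_ascPochhammer,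
      Polynomial.ascPochhammer_smeval_eq_eval]
  have hf : (k.factorial : ℝ) ≠ 0 := by positivity
  simp only [FormalMultilinearSeries.ofScalars_apply_eq, smul_eq_mul, negBinPMF]
  rw [← div_div, gamma_add_nat_div_gamma hr, ← hc]
  field_simp

theorem isProbabilityMeasure_negBinMeasure {r p : ℝ} (hr : 0 < r) (hp0 : 0 < p) (hp1 : p < 1) :
    MeasureTheory.IsProbabilityMeasure (negBinMeasure r p) :=
  (hasSum_negBinPMF hr hp0 hp1).isProbabilityMeasure_sum_dirac (negBinPMF_nonneg hr hp0 hp1)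

/-!
Write `q = 1 - p` and let `m = r p / q + 1 / 2 - (1 + p) / (6 q)` be the asserted median. The
distribution function of `K + U` is the linear interpolation of `k ↦ ℙ(K < k)`, with slope
`P_{r,p}(k)` on `[k, k + 1]`. It is therefore enough to show, for integers `k` within a bounded
distance of `m`,
`ℙ(K < k) - 1 / 2 = P_{r,p}(k) (k - m + O(1 / r))`,
that is, to evaluate the difference `(ℙ(K < k) - ℙ(K ≥ k)) / P_{r,p}(k)` up to `O(1 / r)`.

Both tails are incomplete beta integrals. In a log-odds coordinate centred at the end point,
`ℙ(K ≥ k) / P_{r,p}(k) = k ∫ h(y) dy` over `y > 0`, and `ℙ(K < k) / P_{r,p}(k)` is the same integral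
over `y < 0`, with `h(y) = e ^ (r y) / (p + q e ^ y) ^ n` and `n = r + k`
(`one_sub_sum_range_negBinPMF`, `sum_range_negBinPMF`). These identities follow from recurrences in
`k`, given by integration of the derivative of `h`.

The upper tail minus the lower one, divided by `P_{r,p}(k)`, is thus `k` times the integral of
`h(y) - h(-y) = 2 w(y) sinh (O(y))` over `y > 0`, where `w` is even and `O` is odd. Here
`w = (1 + 2 p q (cosh y - 1)) ^ (-n / 2)` exactly, and near `0` the exponent `O` is a combination of
`sinh y` and `(cosh y - 1) sinh y` up to errors of size `y ^ 3` and `n y ^ 5`.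
Replacing `sinh (O)` by this combination leaves integrals which are elementary after substituting
`cosh y - 1`, so neither Gaussian integrals nor a separate treatment of large `y` is needed. The
error is dominated, on the whole half-line, by a constant times
`n⁻¹ cosh y ^ (4 - c n / 2) sinh y` with `c = p q / 2` (`abs_oddsKernel_sub_le`), whose
integral is of order `n⁻²`.
-/

/-! ### The beta integral in log-odds coordinates -/

/-- The integrand `e ^ (a y) / (p + q e ^ y) ^ (a + b)`, `q = 1 - p`. Up to a constant it is the
beta density `t ^ (a - 1) (1 - t) ^ (b - 1)` in the coordinate `y` for which the odds are
`t / (1 - t) = (q / p) e ^ y`, so that `y = 0` is the point `t = q`; the constant makes the value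
at `y = 0` equal to `1`. -/
noncomputable def oddsKernel (p a b y : ℝ) : ℝ :=
  Real.exp (a * y) * (p + (1 - p) * Real.exp y) ^ (-(a + b))

/-- The integral of `oddsKernel` over the half-line `y > 0`. The other half-line is
`oddsIntegral (1 - p) b a`, by the reflection `y ↦ -y`. -/
noncomputable def oddsIntegral (p a b : ℝ) : ℝ :=
  ∫ y in Set.Ioi (0 : ℝ), oddsKernel p a b y

section OddsKernel

variable {p a b : ℝ}

theorem mix_exp_pos (hp0 : 0 < p) (hp1 : p < 1) (y : ℝ) : 0 < p + (1 - p) * Real.exp y := by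
  have : 0 < 1 - p := by linarith
  positivity

theorem oddsKernel_pos (hp0 : 0 < p) (hp1 : p < 1) (y : ℝ) : 0 < oddsKernel p a b y :=
  mul_pos (Real.exp_pos _) (Real.rpow_pos_of_pos (mix_exp_pos hp0 hp1 y) _)

theorem continuous_oddsKernel (hp0 : 0 < p) (hp1 : p < 1) :
    Continuous (oddsKernel p a b) := by
  unfold oddsKernel
  refine Continuous.mul (by fun_prop) (Continuous.rpow_const (by fun_prop) fun y => Or.inl ?_)
  exact (mix_exp_pos hp0 hp1 y).ne'

theorem oddsKernel_le (hp0 : 0 < p) (hp1 : p < 1) (hab : 0 ≤ a + b) (y : ℝ) :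
    oddsKernel p a b y ≤ (1 - p) ^ (-(a + b)) * Real.exp (-b * y) := by
  have hq : 0 < 1 - p := by linarith
  have h1 : (p + (1 - p) * Real.exp y) ^ (-(a + b)) ≤ ((1 - p) * Real.exp y) ^ (-(a + b)) :=
    Real.rpow_le_rpow_of_nonpos (by positivity) (by linarith) (by linarith)
  rw [Real.mul_rpow hq.le (Real.exp_pos y).le, ← Real.exp_mul] at h1
  calc oddsKernel p a b y
      ≤ Real.exp (a * y) * ((1 - p) ^ (-(a + b)) * Real.exp (y * -(a + b))) :=
        mul_le_mul_of_nonneg_left h1 (Real.exp_pos _).le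
    _ = (1 - p) ^ (-(a + b)) * (Real.exp (a * y) * Real.exp (y * -(a + b))) := by ring
    _ = _ := by rw [← Real.exp_add]; ring_nf

theorem integrableOn_oddsKernel (hp0 : 0 < p) (hp1 : p < 1) (ha : 0 ≤ a) (hb : 0 < b) :
    MeasureTheory.IntegrableOn (oddsKernel p a b) (Set.Ioi 0) := by
  refine MeasureTheory.Integrable.mono'
    ((integrableOn_exp_mul_Ioi (a := -b) (by linarith) 0).const_mul ((1 - p) ^ (-(a + b))))
    (continuous_oddsKernel hp0 hp1).aestronglyMeasurable (Filter.Eventually.of_forall fun y => ?_)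
  rw [Real.norm_of_nonneg (oddsKernel_pos hp0 hp1 y).le]
  exact oddsKernel_le hp0 hp1 (by linarith) y

theorem tendsto_oddsKernel_atTop (hp0 : 0 < p) (hp1 : p < 1) (ha : 0 ≤ a) (hb : 0 < b) :
    Filter.Tendsto (oddsKernel p a b) Filter.atTop (nhds 0) := by
  have h : Filter.Tendsto (fun y => (1 - p) ^ (-(a + b)) * Real.exp (-b * y)) Filter.atTop
      (nhds ((1 - p) ^ (-(a + b)) * 0)) :=
    (Real.tendsto_exp_atBot.comp
      (Filter.tendsto_id.const_mul_atTop_of_neg (by linarith : -b < 0))).const_mul _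
  rw [mul_zero] at h
  exact squeeze_zero (fun y => (oddsKernel_pos hp0 hp1 y).le)
    (oddsKernel_le hp0 hp1 (by linarith)) h

theorem oddsKernel_split (hp0 : 0 < p) (hp1 : p < 1) (y : ℝ) :
    oddsKernel p a b y = p * oddsKernel p a (b + 1) y + (1 - p) * oddsKernel p (a + 1) b y := by
  have hD := mix_exp_pos hp0 hp1 y
  unfold oddsKernel
  rw [show -(a + b) = -(a + (b + 1)) + 1 by ring, show -(a + 1 + b) = -(a + (b + 1)) by ring,
    Real.rpow_add_one hD.ne', show (a + 1) * y = a * y + y by ring, Real.exp_add]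
  ring

theorem hasDerivAt_oddsKernel (hp0 : 0 < p) (hp1 : p < 1) (y : ℝ) :
    HasDerivAt (oddsKernel p a b)
      (a * oddsKernel p a b y - (a + b) * (1 - p) * oddsKernel p (a + 1) b y) y := by
  have hD := mix_exp_pos hp0 hp1 y
  have h1 : HasDerivAt (fun y => Real.exp (a * y)) (Real.exp (a * y) * a) y := by
    simpa using ((hasDerivAt_id y).const_mul a).exp
  have h2 : HasDerivAt (fun y => p + (1 - p) * Real.exp y) ((1 - p) * Real.exp y) y :=
    ((Real.hasDerivAt_exp y).const_mul _).const_add _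
  refine (h1.mul (h2.rpow_const (p := -(a + b)) (Or.inl hD.ne'))).congr_deriv ?_
  unfold oddsKernel
  rw [show -(a + 1 + b) = -(a + b) - 1 by ring, show (a + 1) * y = a * y + y by ring, Real.exp_add]
  ring

/-- The fundamental theorem of calculus for `oddsKernel`, whose derivative is a combination of two
kernels with neighbouring parameters. -/
theorem oddsIntegral_succ_left (hp0 : 0 < p) (hp1 : p < 1) (ha : 0 ≤ a) (hb : 0 < b) :
    (a + b) * (1 - p) * oddsIntegral p (a + 1) b = 1 + a * oddsIntegral p a b := by
  have i1 := (integrableOn_oddsKernel hp0 hp1 ha hb).const_mul a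
  have i2 := (integrableOn_oddsKernel (a := a + 1) hp0 hp1 (by linarith) hb).const_mul
    ((a + b) * (1 - p))
  have h := MeasureTheory.integral_Ioi_of_hasDerivAt_of_tendsto'
    (fun y _ => hasDerivAt_oddsKernel (a := a) (b := b) hp0 hp1 y) (i1.sub i2)
    (tendsto_oddsKernel_atTop hp0 hp1 ha hb)
  rw [MeasureTheory.integral_sub i1 i2, MeasureTheory.integral_const_mul,
    MeasureTheory.integral_const_mul] at h
  have h0 : oddsKernel p a b 0 = 1 := by simp [oddsKernel]
  rw [h0] at h
  unfold oddsIntegral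
  linarith

theorem oddsIntegral_succ_right (hp0 : 0 < p) (hp1 : p < 1) (ha : 0 ≤ a) (hb : 0 < b) :
    b * oddsIntegral p a b = 1 + (a + b) * p * oddsIntegral p a (b + 1) := by
  have h1 := oddsIntegral_succ_left hp0 hp1 ha hb
  have h2 : oddsIntegral p a b
      = p * oddsIntegral p a (b + 1) + (1 - p) * oddsIntegral p (a + 1) b := by
    unfold oddsIntegral
    rw [← MeasureTheory.integral_const_mul, ← MeasureTheory.integral_const_mul,
      ← MeasureTheory.integral_add
        ((integrableOn_oddsKernel hp0 hp1 ha (by linarith)).const_mul p)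
        ((integrableOn_oddsKernel hp0 hp1 (by linarith) hb).const_mul (1 - p))]
    simp_rw [← oddsKernel_split hp0 hp1]
  linear_combination (a + b) * h2 + h1

theorem oddsIntegral_nonneg (hp0 : 0 < p) (hp1 : p < 1) : 0 ≤ oddsIntegral p a b :=
  MeasureTheory.setIntegral_nonneg measurableSet_Ioi fun y _ => (oddsKernel_pos hp0 hp1 y).le

theorem oddsIntegral_anti_right (hp0 : 0 < p) (hp1 : p < 1) (ha : 0 ≤ a) (hb : 0 < b) {b' : ℝ}
    (hbb : b ≤ b') : oddsIntegral p a b' ≤ oddsIntegral p a b := by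
  refine MeasureTheory.setIntegral_mono_on
    (integrableOn_oddsKernel hp0 hp1 ha (hb.trans_le hbb))
    (integrableOn_oddsKernel hp0 hp1 ha hb) measurableSet_Ioi fun y hy => ?_
  refine mul_le_mul_of_nonneg_left ?_ (Real.exp_pos _).le
  refine Real.rpow_le_rpow_of_exponent_le ?_ (by linarith)
  have : 1 ≤ Real.exp y := Real.one_le_exp (le_of_lt hy)
  nlinarith

end OddsKernel

/-! ### Tails of the negative binomial law as integrals -/

section Tails

variable {r p : ℝ}

theorem negBinPMF_pos (hr : 0 < r) (hp0 : 0 < p) (hp1 : p < 1) (k : ℕ) : 0 < negBinPMF r p k := by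
  have h1 := Real.Gamma_pos_of_pos hr
  have h2 : 0 < Real.Gamma (r + k) := Real.Gamma_pos_of_pos (by positivity)
  have h3 : 0 < 1 - p := by linarith
  unfold negBinPMF
  positivity

theorem negBinPMF_succ (hr : 0 < r) (k : ℕ) :
    negBinPMF r p (k + 1) * (k + 1) = negBinPMF r p k * ((r + k) * p) := by
  have h1 := Real.Gamma_pos_of_pos hr
  have h : r + k ≠ 0 := by positivity
  unfold negBinPMF
  rw [Nat.cast_succ, ← add_assoc, Real.Gamma_add_one h, Nat.factorial_succ, pow_succ]
  push_cast
  field_simp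

/-- The lower tail `ℙ(K < k)`. Both sides vanish at `k = 0` and grow by `P_{r,p}(k)`. -/
theorem sum_range_negBinPMF (hr : 0 < r) (hp0 : 0 < p) (hp1 : p < 1) (k : ℕ) :
    ∑ i ∈ Finset.range k, negBinPMF r p i
      = negBinPMF r p k * (k * oddsIntegral (1 - p) k r) := by
  induction k with
  | zero => simp
  | succ k ih =>
    have h := oddsIntegral_succ_left (p := 1 - p) (a := k) (b := r) (by linarith) (by linarith)
      (Nat.cast_nonneg k) hr
    rw [Finset.sum_range_succ, ih, Nat.cast_succ]
    linear_combination (-negBinPMF r p k) * h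
      - oddsIntegral (1 - p) (k + 1) r * negBinPMF_succ (p := p) hr k

theorem tendsto_negBinPMF_mul (hr : 0 < r) (hp0 : 0 < p) (hp1 : p < 1) :
    Filter.Tendsto (fun k : ℕ => negBinPMF r p k * k) Filter.atTop (nhds 0) := by
  rw [← Filter.tendsto_add_atTop_iff_nat 1]
  have hq : 0 < 1 - p := by linarith
  have h : ∀ k : ℕ, negBinPMF r p (k + 1) * ((k + 1 : ℕ) : ℝ)
      = r * p / (1 - p) * negBinPMF (r + 1) p k := by
    intro k
    have h1 := Real.Gamma_pos_of_pos hr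
    unfold negBinPMF
    rw [show r + 1 + (k : ℝ) = r + (k + 1 : ℕ) by push_cast; ring, Real.Gamma_add_one hr.ne',
      Real.rpow_add_one hq.ne', Nat.factorial_succ, pow_succ]
    push_cast
    field_simp
  simp_rw [h]
  simpa using (hasSum_negBinPMF (r := r + 1) (by linarith) hp0
    hp1).summable.tendsto_atTop_zero.const_mul (r * p / (1 - p))

/-- The upper tail `ℙ(K ≥ k)`. -/
theorem one_sub_sum_range_negBinPMF (hr : 0 < r) (hp0 : 0 < p) (hp1 : p < 1) {k : ℕ}
    (hk : 1 ≤ k) :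
    1 - ∑ i ∈ Finset.range k, negBinPMF r p i
      = negBinPMF r p k * (k * oddsIntegral p r k) := by
  -- `S k`, the sum of `ℙ(K < k)` and the right-hand side, is constant for `k ≥ 1` and tends to `1`.
  set S : ℕ → ℝ := fun k => ∑ i ∈ Finset.range k, negBinPMF r p i
    + negBinPMF r p k * (k * oddsIntegral p r k) with hS
  have hstep : ∀ k, 1 ≤ k → S (k + 1) = S k := by
    intro k hk
    have h := oddsIntegral_succ_right (p := p) (a := r) (b := k) hp0 hp1 hr.le
      (by exact_mod_cast hk)
    simp only [hS]
    rw [Finset.sum_range_succ, Nat.cast_succ]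
    linear_combination (-negBinPMF r p k) * h
      + oddsIntegral p r (k + 1) * negBinPMF_succ (p := p) hr k
  have hconst : ∀ m, k ≤ m → S m = S k := fun m hm =>
    Nat.le_induction rfl (fun m hm ih => (hstep m (hk.trans hm)).trans ih) m hm
  have h0 : Filter.Tendsto (fun k : ℕ => negBinPMF r p k * (k * oddsIntegral p r k))
      Filter.atTop (nhds 0) := by
    have hb := (tendsto_negBinPMF_mul hr hp0 hp1).mul_const (oddsIntegral p r 1)
    rw [zero_mul] at hb
    refine squeeze_zero' (Filter.Eventually.of_forall fun k => ?_) ?_ hb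
    · have := (negBinPMF_pos hr hp0 hp1 k).le
      have := oddsIntegral_nonneg (a := r) (b := k) hp0 hp1
      positivity
    · filter_upwards [Filter.eventually_ge_atTop 1] with k hk
      rw [← mul_assoc]
      refine mul_le_mul_of_nonneg_left
        (oddsIntegral_anti_right hp0 hp1 hr.le one_pos (by exact_mod_cast hk)) ?_
      have := (negBinPMF_pos hr hp0 hp1 k).le
      positivity
  have hlim : Filter.Tendsto S Filter.atTop (nhds (1 + 0)) :=
    (hasSum_negBinPMF hr hp0 hp1).tendsto_sum_nat.add h0
  have hlim' : Filter.Tendsto S Filter.atTop (nhds (S k)) :=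
    tendsto_const_nhds.congr' (by
      filter_upwards [Filter.eventually_ge_atTop k] with m hm using (hconst m hm).symm)
  have := tendsto_nhds_unique hlim hlim'
  simp only [hS] at this
  linarith

end Tails

/-- A bound for `f` on `[0, ∞)` from a bound for its derivative. Unlike a Taylor expansion, it
gives estimates that are uniform on the half-line. -/
theorem abs_le_of_abs_deriv_le {f g f' g' : ℝ → ℝ} (hf : ∀ y, HasDerivAt f (f' y) y)
    (hg : ∀ y, HasDerivAt g (g' y) y) (h0 : |f 0| ≤ g 0) (h : ∀ y, 0 ≤ y → |f' y| ≤ g' y)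
    {y : ℝ} (hy : 0 ≤ y) : |f y| ≤ g y :=
  image_norm_le_of_norm_deriv_right_le_deriv_boundary (a := 0) (b := y)
    (fun x _ => (hf x).continuousAt.continuousWithinAt) (fun x _ => (hf x).hasDerivWithinAt) h0 hg
    (fun x hx => h x hx.1) ⟨hy, le_rfl⟩

/-! ### Elementary estimates for hyperbolic functions -/

section Hyperbolic

open Real

theorem cosh_sub_one_le (x : ℝ) : cosh x - 1 ≤ x ^ 2 * cosh x := by
  have h := abs_le_of_abs_deriv_le (f := fun y => cosh y - 1) (g := fun y => y * sinh y)
    (f' := sinh) (g' := fun y => 1 * sinh y + y * cosh y)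
    (fun y => (hasDerivAt_cosh y).sub_const 1)
    (fun y => (hasDerivAt_id y).mul (hasDerivAt_sinh y)) (by simp)
    (fun y hy => by
      have := sinh_nonneg_iff.2 hy
      have := cosh_pos y
      rw [abs_of_nonneg (by assumption)]
      have : 0 ≤ y * cosh y := by positivity
      linarith) (abs_nonneg x)
  have h' := abs_le_of_abs_deriv_le (f := sinh) (g := fun y => y * cosh y)
    (f' := cosh) (g' := fun y => 1 * cosh y + y * sinh y) hasDerivAt_sinh
    (fun y => (hasDerivAt_id y).mul (hasDerivAt_cosh y)) (by simp)
    (fun y hy => by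
      have := sinh_nonneg_iff.2 hy
      rw [abs_of_pos (cosh_pos y)]
      have : 0 ≤ y * sinh y := by positivity
      linarith) (abs_nonneg x)
  have h1 := le_of_abs_le h
  have h2 := mul_le_mul_of_nonneg_left (le_of_abs_le h') (abs_nonneg x)
  simp only [cosh_abs] at h1 h2
  rw [← sq_abs]
  linarith

theorem abs_sinh_sub_self_le (x : ℝ) : |sinh x - x| ≤ |x| ^ 3 * cosh x := by
  have h := abs_le_of_abs_deriv_le (f := fun y => sinh y - y) (g := fun y => y * (cosh y - 1))
    (f' := fun y => cosh y - 1) (g' := fun y => 1 * (cosh y - 1) + y * sinh y)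
    (fun y => (hasDerivAt_sinh y).sub (hasDerivAt_id y))
    (fun y => (hasDerivAt_id y).mul ((hasDerivAt_cosh y).sub_const 1)) (by simp)
    (fun y hy => by
      have := sinh_nonneg_iff.2 hy
      rw [abs_of_nonneg (by linarith [one_le_cosh y])]
      have : 0 ≤ y * sinh y := by positivity
      linarith) (abs_nonneg x)
  have h1 : |sinh x - x| = |sinh (abs x) - abs x| := by
    rcases abs_cases x with ⟨hx, _⟩ | ⟨hx, _⟩ <;> rw [hx]
    rw [sinh_neg, ← abs_neg]; ring_nf
  rw [h1]
  refine h.trans ?_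
  simp only [cosh_abs]
  calc |x| * (cosh x - 1) ≤ |x| * (x ^ 2 * cosh x) :=
        mul_le_mul_of_nonneg_left (cosh_sub_one_le x) (abs_nonneg x)
    _ = |x| ^ 3 * cosh x := by rw [← sq_abs]; ring

theorem hasDerivAt_cosh_sub_one_mul_sinh (y : ℝ) :
    HasDerivAt (fun y => (cosh y - 1) * sinh y)
      (3 * (cosh y - 1) + 2 * (cosh y - 1) ^ 2) y := by
  refine (((hasDerivAt_cosh y).sub_const 1).mul (hasDerivAt_sinh y)).congr_deriv ?_
  linear_combination -(cosh_sq y)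

theorem hasDerivAt_cosh_sub_one_sq_mul_sinh (y : ℝ) :
    HasDerivAt (fun y => (cosh y - 1) ^ 2 * sinh y)
      (2 * (cosh y - 1) * sinh y ^ 2 + (cosh y - 1) ^ 2 * cosh y) y := by
  refine ((((hasDerivAt_cosh y).sub_const 1).pow 2).mul (hasDerivAt_sinh y)).congr_deriv ?_
  simp
  ring

theorem abs_self_sub_sinh_le {y : ℝ} (hy : 0 ≤ y) : |y - sinh y| ≤ (cosh y - 1) * sinh y := by
  refine abs_le_of_abs_deriv_le (f := fun y => y - sinh y)
    (fun y => (hasDerivAt_id y).sub (hasDerivAt_sinh y)) hasDerivAt_cosh_sub_one_mul_sinh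
    (by simp) (fun y _ => ?_) hy
  have := one_le_cosh y
  rw [abs_sub_comm, abs_of_nonneg (by linarith)]
  nlinarith

end Hyperbolic

/-! ### Even and odd parts of the Bernoulli log-moment generating function -/

section LogOdds

open Real

/-- The odd part of `y ↦ log (p + q e ^ y) - q y`, where `q = 1 - p`. The even part is
`log (1 + 2 p q (cosh y - 1)) / 2`, by `mix_exp_mul_mix_exp_neg`. -/
noncomputable def oddLog (p y : ℝ) : ℝ :=
  (log (p + (1 - p) * exp y) - log (p + (1 - p) * exp (-y))) / 2 - (1 - p) * y

variable {p : ℝ}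

theorem mix_exp_mul_mix_exp_neg (p y : ℝ) :
    (p + (1 - p) * exp y) * (p + (1 - p) * exp (-y)) = 1 + 2 * p * (1 - p) * (cosh y - 1) := by
  have h : exp y * exp (-y) = 1 := by rw [← exp_add]; simp
  rw [cosh_eq]
  linear_combination (1 - p) ^ 2 * h

theorem hasDerivAt_oddLog (hp0 : 0 < p) (hp1 : p < 1) (y : ℝ) :
    HasDerivAt (oddLog p) (p * (1 - p) * (2 * p - 1) * (cosh y - 1) /
      (1 + 2 * p * (1 - p) * (cosh y - 1))) y := by
  have hD := mix_exp_pos hp0 hp1 y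
  have hD' := mix_exp_pos hp0 hp1 (-y)
  have h1 := (((hasDerivAt_exp y).const_mul (1 - p)).const_add p).log hD.ne'
  have h2 := (((hasDerivAt_neg y).exp.const_mul (1 - p)).const_add p).log hD'.ne'
  refine (((h1.sub h2).div_const 2).sub ((hasDerivAt_id y).const_mul (1 - p))).congr_deriv ?_
  rw [← mix_exp_mul_mix_exp_neg, cosh_eq]
  have h : exp y * exp (-y) = 1 := by rw [← exp_add]; simp
  set u := exp y
  set v := exp (-y)
  rw [eq_div_iff (by positivity)]
  field_simp
  linear_combination (2 * p * (1 - p) ^ 2) * h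

theorem abs_oddLog_le (hp0 : 0 < p) (hp1 : p < 1) {y : ℝ} (hy : 0 ≤ y) :
    |oddLog p y| ≤ (cosh y - 1) * sinh y := by
  refine abs_le_of_abs_deriv_le (hasDerivAt_oddLog hp0 hp1) hasDerivAt_cosh_sub_one_mul_sinh
    (by simp [oddLog]) (fun y _ => ?_) hy
  have hC := one_le_cosh y
  set C := cosh y - 1
  have hC : 0 ≤ C := by linarith
  have hq : 0 < 1 - p := by linarith
  have hD : 1 ≤ 1 + 2 * p * (1 - p) * C := by
    have : 0 ≤ 2 * p * (1 - p) * C := by positivity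
    linarith
  have hA : |p * (1 - p) * (2 * p - 1)| ≤ 1 := by
    rw [abs_le]; constructor <;> nlinarith [mul_pos hp0 hq]
  rw [abs_div, abs_mul, abs_of_nonneg hC, abs_of_pos (by linarith : 0 < 1 + 2 * p * (1 - p) * C),
    div_le_iff₀ (by linarith)]
  nlinarith [mul_le_mul_of_nonneg_right hA hC, mul_nonneg hC (sub_nonneg.2 hD), sq_nonneg C]

/-- The leading term of `oddLog` is cubic in `y`; it is written as a multiple of
`(cosh y - 1) sinh y`, which can be integrated exactly against `evenWeight`. -/
theorem abs_oddLog_sub_le (hp0 : 0 < p) (hp1 : p < 1) {y : ℝ} (hy : 0 ≤ y) :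
    |oddLog p y - p * (1 - p) * (2 * p - 1) / 3 * ((cosh y - 1) * sinh y)|
      ≤ (cosh y - 1) ^ 2 * sinh y := by
  refine abs_le_of_abs_deriv_le
    (f := fun y => oddLog p y - p * (1 - p) * (2 * p - 1) / 3 * ((cosh y - 1) * sinh y))
    (fun y => (hasDerivAt_oddLog hp0 hp1 y).sub
      ((hasDerivAt_cosh_sub_one_mul_sinh y).const_mul _)) hasDerivAt_cosh_sub_one_sq_mul_sinh
    (by simp [oddLog]) (fun y hy => ?_) hy
  have hC := one_le_cosh y
  set C := cosh y - 1 with hCdef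
  have hC : 0 ≤ C := by linarith
  have hq : 0 < 1 - p := by linarith
  have ha0 : 0 < 2 * p * (1 - p) := by positivity
  have ha1 : 2 * p * (1 - p) ≤ 1 := by nlinarith [sq_nonneg (2 * p - 1)]
  have hD : 1 ≤ 1 + 2 * p * (1 - p) * C := by
    have : 0 ≤ 2 * p * (1 - p) * C := by positivity
    linarith
  have hA : |p * (1 - p) * (2 * p - 1)| ≤ 1 / 4 := by
    rw [abs_le]; constructor <;> nlinarith [mul_pos hp0 hq, sq_nonneg (2 * p - 1)]
  have e : p * (1 - p) * (2 * p - 1) * C / (1 + 2 * p * (1 - p) * C)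
      - p * (1 - p) * (2 * p - 1) / 3 * (3 * C + 2 * C ^ 2)
      = -(p * (1 - p) * (2 * p - 1)) *
        ((2 * p * (1 - p) / (1 + 2 * p * (1 - p) * C) + 2 / 3) * C ^ 2) := by
    field_simp
    ring
  have hb : 2 * p * (1 - p) / (1 + 2 * p * (1 - p) * C) ≤ 1 := by
    rw [div_le_one (by linarith)]; nlinarith
  have hb0 : 0 ≤ 2 * p * (1 - p) / (1 + 2 * p * (1 - p) * C) := by positivity
  rw [e, abs_mul, abs_neg, abs_of_nonneg (by positivity :
    0 ≤ (2 * p * (1 - p) / (1 + 2 * p * (1 - p) * C) + 2 / 3) * C ^ 2)]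
  have h1 : (2 * p * (1 - p) / (1 + 2 * p * (1 - p) * C) + 2 / 3) * C ^ 2 ≤ 2 * C ^ 2 :=
    mul_le_mul_of_nonneg_right (by linarith) (sq_nonneg C)
  have h2 : |p * (1 - p) * (2 * p - 1)| *
      ((2 * p * (1 - p) / (1 + 2 * p * (1 - p) * C) + 2 / 3) * C ^ 2) ≤ 1 / 4 * (2 * C ^ 2) :=
    mul_le_mul hA h1 (by positivity) (by norm_num)
  have h3 : C ^ 2 * 1 ≤ C ^ 2 * cosh y :=
    mul_le_mul_of_nonneg_left (one_le_cosh y) (sq_nonneg C)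
  have h4 : 0 ≤ 2 * C * sinh y ^ 2 := by positivity
  nlinarith [sq_nonneg C]

/-- Convexity of `log (p + q e ^ y)` in a global form: it exceeds its tangent `q y` at `0` by at
least a multiple of `log (cosh y)`, which is quadratic near `0` and linear at infinity. -/
theorem exp_mul_cosh_rpow_le (hp0 : 0 < p) (hp1 : p < 1) {y : ℝ} (hy : 0 ≤ y) :
    exp ((1 - p) * y) * cosh y ^ (p * (1 - p) / 2) ≤ p + (1 - p) * exp y := by
  have hD := mix_exp_pos hp0 hp1
  have hq : 0 < 1 - p := by linarith
  -- The difference of the logarithms has a nonnegative derivative on `[0, ∞)`.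
  have key := abs_le_of_abs_deriv_le (f := fun _ => (0 : ℝ)) (f' := fun _ => 0)
    (g := fun y => log (p + (1 - p) * exp y) - (1 - p) * y - p * (1 - p) / 2 * log (cosh y))
    (fun y => hasDerivAt_const y 0)
    (fun y => (((((hasDerivAt_exp y).const_mul (1 - p)).const_add p).log (hD y).ne').sub
      ((hasDerivAt_id y).const_mul (1 - p))).sub
      (((hasDerivAt_cosh y).log (cosh_pos y).ne').const_mul _)) (by simp)
    (fun y hy => by
      have hu : 1 ≤ exp y := one_le_exp hy
      rw [abs_zero, sinh_eq, cosh_eq, exp_neg]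
      have hDy := hD y
      set u := exp y
      have e : (1 - p) * u / (p + (1 - p) * u) - (1 - p) * 1
          - p * (1 - p) / 2 * ((u - u⁻¹) / 2 / ((u + u⁻¹) / 2))
          = p * (1 - p) * (u - 1) * (2 * (u ^ 2 + 1) - (u + 1) * (p + (1 - p) * u))
            / (2 * (p + (1 - p) * u) * (u ^ 2 + 1)) := by
        field_simp
        ring
      rw [e]
      have h1 : 0 ≤ u - 1 := by linarith
      have h2 : 0 ≤ 2 * (u ^ 2 + 1) - (u + 1) * (p + (1 - p) * u) := by nlinarith
      positivity) hy
  have key := le_of_abs_le key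
  simp only [sub_nonneg] at key
  rw [← exp_log (hD y), rpow_def_of_pos (cosh_pos y), ← exp_add, exp_le_exp]
  linarith

end LogOdds

/-! ### Pointwise comparison of the two integrands -/

section Pointwise

open Real

variable {p a b : ℝ}

/-- The geometric mean of the two integrands: `(1 + 2 p q (cosh y - 1)) ^ (-n / 2)`, where
`n = a + b`. -/
noncomputable def evenWeight (p n y : ℝ) : ℝ :=
  (1 + 2 * p * (1 - p) * (cosh y - 1)) ^ (-(n / 2))

/-- Half the logarithm of the ratio of the two integrands, an odd function of `y`. -/
noncomputable def oddExponent (p a b y : ℝ) : ℝ :=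
  (a - (a + b) * (1 - p)) * y - (a + b) * oddLog p y

/-- The approximation of `oddExponent` by a combination of `sinh y` and `(cosh y - 1) sinh y`. When
the linear coefficient `a - (a + b) (1 - p)` is bounded, the error near `0` is of size
`y ^ 3 + n y ^ 5`; on the relevant scale `y = s / √n` this is `n ^ (-3 / 2)`. -/
noncomputable def oddExponentApprox (p a b y : ℝ) : ℝ :=
  (a - (a + b) * (1 - p)) * sinh y
    - (a + b) * (p * (1 - p) * (2 * p - 1) / 3 * ((cosh y - 1) * sinh y))

theorem evenWeight_pos (hp0 : 0 < p) (hp1 : p < 1) (n y : ℝ) : 0 < evenWeight p n y := by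
  have h := mul_pos (mix_exp_pos hp0 hp1 y) (mix_exp_pos hp0 hp1 (-y))
  rw [mix_exp_mul_mix_exp_neg] at h
  exact rpow_pos_of_pos h _

theorem oddsKernel_eq_evenWeight_mul (hp0 : 0 < p) (hp1 : p < 1) (y : ℝ) :
    oddsKernel p a b y = evenWeight p (a + b) y * exp (oddExponent p a b y) := by
  have hD := mix_exp_pos hp0 hp1 y
  have hD' := mix_exp_pos hp0 hp1 (-y)
  unfold oddsKernel evenWeight oddExponent oddLog
  rw [← mix_exp_mul_mix_exp_neg, rpow_def_of_pos hD, rpow_def_of_pos (mul_pos hD hD'),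
    log_mul hD.ne' hD'.ne', ← exp_add, ← exp_add]
  ring_nf

theorem oddsKernel_swap_eq_evenWeight_mul (hp0 : 0 < p) (hp1 : p < 1) (y : ℝ) :
    oddsKernel (1 - p) b a y = evenWeight p (a + b) y * exp (-oddExponent p a b y) := by
  have hD := mix_exp_pos hp0 hp1 y
  have hD' := mix_exp_pos hp0 hp1 (-y)
  have e : (1 - p) + (1 - (1 - p)) * exp y = exp y * (p + (1 - p) * exp (-y)) := by
    have h : exp y * exp (-y) = 1 := by rw [← exp_add]; simp
    linear_combination (-(1 - p)) * h
  unfold oddsKernel evenWeight oddExponent oddLog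
  rw [e, ← mix_exp_mul_mix_exp_neg, rpow_def_of_pos (mul_pos (exp_pos _) hD'),
    rpow_def_of_pos (mul_pos hD hD'), log_mul hD.ne' hD'.ne', log_mul (exp_pos _).ne' hD'.ne',
    log_exp, ← exp_add, ← exp_add]
  ring_nf

theorem oddsKernel_le_cosh (hp0 : 0 < p) (hp1 : p < 1) (hab : 0 ≤ a + b) {y : ℝ} (hy : 0 ≤ y) :
    oddsKernel p a b y
      ≤ exp ((a - (a + b) * (1 - p)) * y) * cosh y ^ (-(p * (1 - p) / 2 * (a + b))) := by
  have hc : 0 < cosh y ^ (p * (1 - p) / 2) := rpow_pos_of_pos (cosh_pos y) _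
  have h := rpow_le_rpow_of_nonpos (mul_pos (exp_pos _) hc) (exp_mul_cosh_rpow_le hp0 hp1 hy)
    (by linarith : -(a + b) ≤ 0)
  rw [mul_rpow (exp_pos _).le hc.le, ← exp_mul, ← rpow_mul (cosh_pos y).le] at h
  calc oddsKernel p a b y ≤ exp (a * y) * (exp ((1 - p) * y * -(a + b))
        * cosh y ^ (p * (1 - p) / 2 * -(a + b))) := mul_le_mul_of_nonneg_left h (exp_pos _).le
    _ = _ := by
      rw [← mul_assoc, ← exp_add]
      ring_nf

theorem exp_mul_le_cosh {e y : ℝ} (he : |e| ≤ 3) (hy : 0 ≤ y) : exp (e * y) ≤ 8 * cosh y ^ 3 := by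
  have h1 : exp y ≤ 2 * cosh y := by
    rw [cosh_eq]; linarith [exp_pos (-y)]
  calc exp (e * y) ≤ exp (3 * y) :=
        exp_le_exp.2 (mul_le_mul_of_nonneg_right (le_of_abs_le he) hy)
    _ = exp y ^ 3 := by rw [← exp_nat_mul]; norm_num
    _ ≤ (2 * cosh y) ^ 3 := pow_le_pow_left₀ (exp_pos _).le h1 3
    _ = 8 * cosh y ^ 3 := by ring

/-- The left-hand side is the arithmetic mean of the two integrands. -/
theorem evenWeight_mul_cosh_le (hp0 : 0 < p) (hp1 : p < 1) (hab : 0 ≤ a + b)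
    (he : |a - (a + b) * (1 - p)| ≤ 3) {y : ℝ} (hy : 0 ≤ y) :
    evenWeight p (a + b) y * cosh (oddExponent p a b y)
      ≤ 8 * cosh y ^ (3 - p * (1 - p) / 2 * (a + b)) := by
  have h1 := oddsKernel_le_cosh hp0 hp1 hab hy
  have h2 := oddsKernel_le_cosh (p := 1 - p) (a := b) (b := a) (by linarith) (by linarith)
    (by linarith) hy
  have e2 : b - (b + a) * (1 - (1 - p)) = -(a - (a + b) * (1 - p)) := by ring
  have e3 : (1 - p) * (1 - (1 - p)) / 2 * (b + a) = p * (1 - p) / 2 * (a + b) := by ring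
  rw [e2, e3] at h2
  rw [oddsKernel_eq_evenWeight_mul hp0 hp1] at h1
  rw [oddsKernel_swap_eq_evenWeight_mul hp0 hp1] at h2
  have hc : 0 ≤ cosh y ^ (-(p * (1 - p) / 2 * (a + b))) := (rpow_pos_of_pos (cosh_pos y) _).le
  have h1' := h1.trans (mul_le_mul_of_nonneg_right (exp_mul_le_cosh he hy) hc)
  have h2' := h2.trans (mul_le_mul_of_nonneg_right
    (exp_mul_le_cosh (by rw [abs_neg]; exact he) hy) hc)
  have e4 : cosh y ^ (3 - p * (1 - p) / 2 * (a + b))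
      = cosh y ^ 3 * cosh y ^ (-(p * (1 - p) / 2 * (a + b))) := by
    rw [sub_eq_add_neg, rpow_add (cosh_pos y)]
    norm_cast
  rw [e4, cosh_eq (oddExponent p a b y)]
  linarith

theorem abs_oddExponent_le (hp0 : 0 < p) (hp1 : p < 1) (hab : 0 ≤ a + b)
    (he : |a - (a + b) * (1 - p)| ≤ 3) {y : ℝ} (hy : 0 ≤ y) :
    |oddExponent p a b y| ≤ (3 + (a + b) * (cosh y - 1)) * sinh y := by
  have h1 := mul_le_mul he ((self_le_sinh_iff.2 hy)) hy (by norm_num)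
  have h2 := mul_le_mul_of_nonneg_left (abs_oddLog_le hp0 hp1 hy) hab
  calc |oddExponent p a b y| ≤ |a - (a + b) * (1 - p)| * y + (a + b) * |oddLog p y| := by
        refine (abs_sub _ _).trans_eq ?_
        rw [abs_mul, abs_mul, abs_of_nonneg hy, abs_of_nonneg hab]
    _ ≤ _ := by linarith

theorem abs_oddExponent_sub_approx_le (hp0 : 0 < p) (hp1 : p < 1) (hab : 0 ≤ a + b)
    (he : |a - (a + b) * (1 - p)| ≤ 3) {y : ℝ} (hy : 0 ≤ y) :
    |oddExponent p a b y - oddExponentApprox p a b y|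
      ≤ (3 * (cosh y - 1) + (a + b) * (cosh y - 1) ^ 2) * sinh y := by
  have h1 := mul_le_mul he (abs_self_sub_sinh_le hy) (abs_nonneg _) (by norm_num)
  have h2 := mul_le_mul_of_nonneg_left (abs_oddLog_sub_le hp0 hp1 hy) hab
  have e : oddExponent p a b y - oddExponentApprox p a b y
      = (a - (a + b) * (1 - p)) * (y - sinh y) - (a + b) *
        (oddLog p y - p * (1 - p) * (2 * p - 1) / 3 * ((cosh y - 1) * sinh y)) := by
    unfold oddExponent oddExponentApprox
    ring
  rw [e]
  refine (abs_sub _ _).trans ?_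
  rw [abs_mul, abs_mul, abs_of_nonneg hab]
  linarith

/-- Powers of `n (cosh y - 1)` are absorbed by half of the decay `cosh y ^ (-c n)`. -/
theorem pow_four_le_cosh_rpow {c n : ℝ} (hc0 : 0 < c) (hc1 : c ≤ 1) (hn : 8 ≤ c * n) (y : ℝ) :
    (3 + n * (cosh y - 1)) ^ 4 ≤ (8 / c) ^ 4 * cosh y ^ (c * n / 2) := by
  have hC := one_le_cosh y
  -- Bernoulli's inequality for the fourth root of the right-hand side.
  have h := one_add_mul_self_le_rpow_one_add (s := cosh y - 1) (p := c * n / 8) (by linarith)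
    (by linarith)
  have h8 : 3 ≤ 8 / c := by rw [le_div_iff₀ hc0]; linarith
  have hn0 : 0 < n := by
    by_contra! hn'
    nlinarith
  have hX : 0 ≤ n * (cosh y - 1) := mul_nonneg hn0.le (by linarith)
  have h2 : 3 + n * (cosh y - 1) ≤ 8 / c * cosh y ^ (c * n / 8) := by
    calc 3 + n * (cosh y - 1) ≤ 8 / c + n * (cosh y - 1) := by linarith
      _ = 8 / c * (1 + c * n / 8 * (cosh y - 1)) := by field_simp
      _ ≤ 8 / c * cosh y ^ (c * n / 8) := by
        rw [add_sub_cancel] at h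
        exact mul_le_mul_of_nonneg_left h (by positivity)
  calc (3 + n * (cosh y - 1)) ^ 4 ≤ (8 / c * cosh y ^ (c * n / 8)) ^ 4 :=
        pow_le_pow_left₀ (by linarith) h2 4
    _ = (8 / c) ^ 4 * cosh y ^ (c * n / 2) := by
      rw [mul_pow, ← rpow_mul_natCast (cosh_pos y).le]
      congr 2
      push_cast
      ring

/-- The difference of the integrands is `2 w sinh O`, with `w = evenWeight` and `O = oddExponent`.
Replacing `sinh O` by the approximation `M` of `O` costs at most `w cosh O` times a polynomial in
`X = n (cosh y - 1)` times `cosh y sinh y / n`, and the decay of `w cosh O` absorbs the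
polynomial. -/
theorem abs_oddsKernel_sub_le (hp0 : 0 < p) (hp1 : p < 1)
    (hn : 8 ≤ p * (1 - p) / 2 * (a + b)) (hn0 : 0 < a + b)
    (he : |a - (a + b) * (1 - p)| ≤ 3) {y : ℝ} (hy : 0 ≤ y) :
    |oddsKernel p a b y - oddsKernel (1 - p) b a y
        - 2 * (evenWeight p (a + b) y * oddExponentApprox p a b y)|
      ≤ 48 * (8 / (p * (1 - p) / 2)) ^ 4 / (a + b)
        * (cosh y ^ (4 - p * (1 - p) / 2 * (a + b) / 2) * sinh y) := by
  have hq : 0 < 1 - p := by linarith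
  have hC := one_le_cosh y
  have hS := sinh_nonneg_iff.2 hy
  set c := p * (1 - p) / 2 with hc
  have hc0 : 0 < c := by positivity
  have hc1 : c ≤ 1 := by nlinarith
  set n := a + b with hnd
  set O := oddExponent p a b y
  set M := oddExponentApprox p a b y
  set w := evenWeight p n y
  have hw : 0 < w := evenWeight_pos hp0 hp1 n y
  set X := n * (cosh y - 1) with hX
  have hX0 : 0 ≤ X := mul_nonneg hn0.le (by linarith)
  have hWc : w * cosh O ≤ 8 * cosh y ^ (3 - c * n) := evenWeight_mul_cosh_le hp0 hp1 hn0.le he hy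
  have hO : |O| ≤ (3 + X) * sinh y := abs_oddExponent_le hp0 hp1 hn0.le he hy
  have hOM : |O - M| ≤ (3 * (cosh y - 1) + n * (cosh y - 1) ^ 2) * sinh y :=
    abs_oddExponent_sub_approx_le hp0 hp1 hn0.le he hy
  have hOM' : |O - M| ≤ (3 + X) ^ 4 / n * (cosh y * sinh y) := by
    refine hOM.trans ?_
    have e : (3 * (cosh y - 1) + n * (cosh y - 1) ^ 2) * sinh y
        = (3 * X + X ^ 2) / n * (1 * sinh y) := by
      rw [hX]; field_simp
    rw [e]
    have : 3 * X + X ^ 2 ≤ (3 + X) ^ 4 := by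
      have : 0 ≤ X ^ 2 := sq_nonneg X
      have : 0 ≤ X ^ 3 := by positivity
      have : 0 ≤ X ^ 4 := by positivity
      nlinarith
    gcongr
  have hO3 : |O| ^ 3 ≤ 2 * (3 + X) ^ 4 / n * (cosh y * sinh y) := by
    calc |O| ^ 3 ≤ ((3 + X) * sinh y) ^ 3 := pow_le_pow_left₀ (abs_nonneg _) hO 3
      _ = (3 + X) ^ 3 * (sinh y ^ 2) * sinh y := by ring
      _ = (3 + X) ^ 3 * ((cosh y - 1) * (cosh y + 1)) * sinh y := by rw [sinh_sq]; ring
      _ ≤ (3 + X) ^ 3 * ((cosh y - 1) * (2 * cosh y)) * sinh y := by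
        have : 0 ≤ cosh y - 1 := by linarith
        gcongr
        linarith
      _ = 2 * ((3 + X) ^ 3 * X) / n * (cosh y * sinh y) := by rw [hX]; field_simp
      _ ≤ 2 * ((3 + X) ^ 3 * (3 + X)) / n * (cosh y * sinh y) := by
        gcongr
        linarith
      _ = _ := by ring
  have e : oddsKernel p a b y - oddsKernel (1 - p) b a y - 2 * (w * M)
      = 2 * w * ((sinh O - O) + (O - M)) := by
    rw [oddsKernel_eq_evenWeight_mul hp0 hp1, oddsKernel_swap_eq_evenWeight_mul hp0 hp1, sinh_eq]
    ring
  have hsum : |(sinh O - O) + (O - M)| ≤ cosh O * (3 * (3 + X) ^ 4 / n * (cosh y * sinh y)) := by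
    have h1 : |O - M| * 1 ≤ (3 + X) ^ 4 / n * (cosh y * sinh y) * cosh O :=
      mul_le_mul hOM' (one_le_cosh O) zero_le_one ((abs_nonneg _).trans hOM')
    have h2 := mul_le_mul_of_nonneg_right hO3 (cosh_pos O).le
    calc _ ≤ |sinh O - O| + |O - M| := abs_add_le _ _
      _ ≤ 2 * (3 + X) ^ 4 / n * (cosh y * sinh y) * cosh O
          + (3 + X) ^ 4 / n * (cosh y * sinh y) * cosh O := by
        linarith [abs_sinh_sub_self_le O]
      _ = _ := by ring
  rw [e, abs_mul, abs_of_pos (by positivity : 0 < 2 * w)]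
  calc 2 * w * |(sinh O - O) + (O - M)|
      ≤ 2 * w * (cosh O * (3 * (3 + X) ^ 4 / n * (cosh y * sinh y))) := by gcongr
    _ = w * cosh O * (3 + X) ^ 4 * (6 / n * (cosh y * sinh y)) := by ring
    _ ≤ (8 * cosh y ^ (3 - c * n)) * ((8 / c) ^ 4 * cosh y ^ (c * n / 2))
        * (6 / n * (cosh y * sinh y)) := by
      have := pow_four_le_cosh_rpow hc0 hc1 hn y
      gcongr
    _ = 48 * (8 / c) ^ 4 / n * (cosh y ^ (3 - c * n) * cosh y ^ (c * n / 2) * cosh y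
        * sinh y) := by ring
    _ = _ := by
      rw [← rpow_add (cosh_pos y), ← rpow_add_one (cosh_pos y).ne']
      ring_nf

end Pointwise

/-! ### Exact integrals of the even weight -/

section Integrals

open Real MeasureTheory

theorem tendsto_one_add_mul_cosh_rpow {α s : ℝ} (hα : 0 < α) (hs : 1 < s) :
    Filter.Tendsto (fun y => -((1 + α * (cosh y - 1)) ^ (1 - s) / (α * (s - 1)))) Filter.atTop
      (nhds 0) := by
  have hcosh : Filter.Tendsto cosh Filter.atTop Filter.atTop := by
    refine Filter.tendsto_atTop_mono (fun y => ?_)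
      (tendsto_exp_atTop.atTop_div_const (by norm_num : (0 : ℝ) < 2))
    rw [cosh_eq]; linarith [exp_pos (-y)]
  have h1 : Filter.Tendsto (fun y => 1 + α * (cosh y - 1)) Filter.atTop Filter.atTop :=
    Filter.tendsto_atTop_add_const_left _ _
      ((Filter.tendsto_atTop_add_const_right _ (-1) hcosh).const_mul_atTop hα)
  have h2 := ((tendsto_rpow_neg_atTop (by linarith : 0 < s - 1)).comp h1).div_const (α * (s - 1))
  simpa [neg_sub] using h2.neg

theorem hasDerivAt_one_add_mul_cosh_rpow {α s : ℝ} (hα : 0 < α) (hs : 1 < s) (y : ℝ) :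
    HasDerivAt (fun y => -((1 + α * (cosh y - 1)) ^ (1 - s) / (α * (s - 1))))
      ((1 + α * (cosh y - 1)) ^ (-s) * sinh y) y := by
  have hD : 0 < 1 + α * (cosh y - 1) := by
    have : 0 ≤ α * (cosh y - 1) := mul_nonneg hα.le (by linarith [one_le_cosh y])
    linarith
  have h1 := ((((hasDerivAt_cosh y).sub_const 1).const_mul α).const_add 1).rpow_const
    (p := 1 - s) (Or.inl hD.ne')
  refine (h1.div_const (α * (s - 1))).neg.congr_deriv ?_
  have : s - 1 ≠ 0 := by linarith
  rw [show 1 - s - 1 = -s by ring]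
  field_simp
  ring

theorem one_add_mul_cosh_rpow_mul_sinh_nonneg {α : ℝ} (hα : 0 < α) (s : ℝ) {y : ℝ} (hy : 0 ≤ y) :
    0 ≤ (1 + α * (cosh y - 1)) ^ (-s) * sinh y := by
  have : 0 ≤ α * (cosh y - 1) := mul_nonneg hα.le (by linarith [one_le_cosh y])
  exact mul_nonneg (rpow_nonneg (by linarith) _) (sinh_nonneg_iff.2 hy)

/-- Substituting `cosh y - 1` makes the integrand a power with an explicit primitive. -/
theorem integrableOn_one_add_mul_cosh_rpow {α s : ℝ} (hα : 0 < α) (hs : 1 < s) :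
    IntegrableOn (fun y => (1 + α * (cosh y - 1)) ^ (-s) * sinh y) (Set.Ioi 0) :=
  integrableOn_Ioi_deriv_of_nonneg' (fun y _ => hasDerivAt_one_add_mul_cosh_rpow hα hs y)
    (fun _ hy => one_add_mul_cosh_rpow_mul_sinh_nonneg hα s (le_of_lt hy))
    (tendsto_one_add_mul_cosh_rpow hα hs)

theorem integral_one_add_mul_cosh_rpow {α s : ℝ} (hα : 0 < α) (hs : 1 < s) :
    ∫ y in Set.Ioi 0, (1 + α * (cosh y - 1)) ^ (-s) * sinh y = 1 / (α * (s - 1)) := by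
  rw [integral_Ioi_of_hasDerivAt_of_nonneg'
    (fun y _ => hasDerivAt_one_add_mul_cosh_rpow hα hs y)
    (fun _ hy => one_add_mul_cosh_rpow_mul_sinh_nonneg hα s (le_of_lt hy))
    (tendsto_one_add_mul_cosh_rpow hα hs)]
  simp

theorem one_add_mul_cosh_rpow_mul_cosh {α : ℝ} (hα : 0 < α) (s y : ℝ) :
    (1 + α * (cosh y - 1)) ^ (-s) * ((cosh y - 1) * sinh y)
      = α⁻¹ * ((1 + α * (cosh y - 1)) ^ (-(s - 1)) * sinh y
        - (1 + α * (cosh y - 1)) ^ (-s) * sinh y) := by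
  have hD : 0 < 1 + α * (cosh y - 1) := by
    have : 0 ≤ α * (cosh y - 1) := mul_nonneg hα.le (by linarith [one_le_cosh y])
    linarith
  rw [show -(s - 1) = -s + 1 by ring, rpow_add_one hD.ne']
  field_simp
  ring

end Integrals

/-! ### The difference of the two tails -/

section Difference

open Real MeasureTheory

variable {p a b : ℝ}

theorem evenWeight_mul_oddExponentApprox (hp0 : 0 < p) (hp1 : p < 1) (y : ℝ) :
    evenWeight p (a + b) y * oddExponentApprox p a b y
      = (a - (a + b) * (1 - p)) * ((1 + 2 * p * (1 - p) * (cosh y - 1)) ^ (-((a + b) / 2)) * sinh y)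
        - (a + b) * (2 * p - 1) / 6 *
          ((1 + 2 * p * (1 - p) * (cosh y - 1)) ^ (-((a + b) / 2 - 1)) * sinh y
            - (1 + 2 * p * (1 - p) * (cosh y - 1)) ^ (-((a + b) / 2)) * sinh y) := by
  have hq : 0 < 1 - p := by linarith
  have h := one_add_mul_cosh_rpow_mul_cosh (α := 2 * p * (1 - p)) (by positivity) ((a + b) / 2) y
  have h' := (eq_inv_mul_iff_mul_eq₀ (by positivity)).1 h
  unfold evenWeight oddExponentApprox
  rw [← h']
  ring

theorem integrableOn_evenWeight_mul (hp0 : 0 < p) (hp1 : p < 1) (hn : 4 < a + b) :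
    IntegrableOn (fun y => evenWeight p (a + b) y * oddExponentApprox p a b y) (Set.Ioi 0) := by
  have hq : 0 < 1 - p := by linarith
  simp_rw [evenWeight_mul_oddExponentApprox hp0 hp1]
  have i1 := integrableOn_one_add_mul_cosh_rpow (α := 2 * p * (1 - p)) (s := (a + b) / 2)
    (by positivity) (by linarith)
  have i2 := integrableOn_one_add_mul_cosh_rpow (α := 2 * p * (1 - p)) (s := (a + b) / 2 - 1)
    (by positivity) (by linarith)
  exact (i1.const_mul _).sub ((i2.sub i1).const_mul _)

theorem integral_evenWeight_mul (hp0 : 0 < p) (hp1 : p < 1) (hn : 4 < a + b) :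
    ∫ y in Set.Ioi 0, evenWeight p (a + b) y * oddExponentApprox p a b y
      = (a - (a + b) * (1 - p)) / (p * (1 - p) * (a + b - 2))
        - (a + b) * (2 * p - 1) / (3 * (p * (1 - p)) * ((a + b - 2) * (a + b - 4))) := by
  have hq : 0 < 1 - p := by linarith
  simp_rw [evenWeight_mul_oddExponentApprox hp0 hp1]
  have i1 := integrableOn_one_add_mul_cosh_rpow (α := 2 * p * (1 - p)) (s := (a + b) / 2)
    (by positivity) (by linarith)
  have i2 := integrableOn_one_add_mul_cosh_rpow (α := 2 * p * (1 - p)) (s := (a + b) / 2 - 1)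
    (by positivity) (by linarith)
  have i3 := (i2.sub i1).const_mul ((a + b) * (2 * p - 1) / 6)
  simp only [Pi.sub_apply] at i3
  rw [integral_sub (i1.const_mul _) i3, integral_const_mul,
    integral_const_mul, integral_sub i2 i1,
    integral_one_add_mul_cosh_rpow (by positivity) (by linarith),
    integral_one_add_mul_cosh_rpow (by positivity) (by linarith)]
  have h2 : a + b - 2 ≠ 0 := by linarith
  have h4 : a + b - 4 ≠ 0 := by linarith
  rw [show (a + b) / 2 - 1 - 1 = (a + b - 4) / 2 by ring,
    show (a + b) / 2 - 1 = (a + b - 2) / 2 by ring]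
  field_simp
  ring

/-- The two half-line integrals are of order `n ^ (-1 / 2)`, but their difference is known up to
`O(n ^ (-2))`. -/
theorem abs_oddsIntegral_sub_le (hp0 : 0 < p) (hp1 : p < 1) (ha : 0 < a) (hb : 0 < b)
    (hn : 20 ≤ p * (1 - p) / 2 * (a + b)) (he : |a - (a + b) * (1 - p)| ≤ 3) :
    |oddsIntegral p a b - oddsIntegral (1 - p) b a
        - 2 * ((a - (a + b) * (1 - p)) / (p * (1 - p) * (a + b - 2))
          - (a + b) * (2 * p - 1) / (3 * (p * (1 - p)) * ((a + b - 2) * (a + b - 4))))|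
      ≤ 192 * (8 / (p * (1 - p) / 2)) ^ 4 / (p * (1 - p) / 2) / (a + b) ^ 2 := by
  have hq : 0 < 1 - p := by linarith
  have hc1 : p * (1 - p) / 2 ≤ 1 := by nlinarith
  have hn4 : 4 < a + b := by nlinarith
  have i1 := integrableOn_oddsKernel hp0 hp1 ha.le hb
  have i2 := integrableOn_oddsKernel (p := 1 - p) (a := b) (b := a) hq (by linarith) hb.le ha
  have i3 := (integrableOn_evenWeight_mul (a := a) (b := b) hp0 hp1 hn4).const_mul 2
  have hs : 1 < p * (1 - p) / 2 * (a + b) / 2 - 4 := by linarith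
  have i4 := integrableOn_one_add_mul_cosh_rpow one_pos hs
  have v4 := integral_one_add_mul_cosh_rpow one_pos hs
  simp only [one_mul, add_sub_cancel, neg_sub] at i4 v4
  rw [← integral_evenWeight_mul hp0 hp1 hn4, ← integral_const_mul]
  unfold oddsIntegral
  have i12 : IntegrableOn (fun y => oddsKernel p a b y - oddsKernel (1 - p) b a y) (Set.Ioi 0) :=
    i1.sub i2
  rw [← integral_sub i1 i2, ← integral_sub i12 i3]
  have hbound : ∀ᵐ y ∂volume.restrict (Set.Ioi 0),
      ‖oddsKernel p a b y - oddsKernel (1 - p) b a y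
          - 2 * (evenWeight p (a + b) y * oddExponentApprox p a b y)‖
        ≤ 48 * (8 / (p * (1 - p) / 2)) ^ 4 / (a + b)
          * (cosh y ^ (4 - p * (1 - p) / 2 * (a + b) / 2) * sinh y) := by
    filter_upwards [ae_restrict_mem measurableSet_Ioi] with y hy
    exact abs_oddsKernel_sub_le hp0 hp1 (by linarith) (by linarith) he (le_of_lt hy)
  refine (norm_integral_le_of_norm_le (i4.const_mul _) hbound).trans ?_
  rw [integral_const_mul, v4]
  set c := p * (1 - p) / 2 with hc
  have hc0 : 0 < c := by positivity
  have hn0 : 0 < a + b := by linarith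
  have h : 1 / (c * (a + b) / 2 - 4 - 1) ≤ 4 / (c * (a + b)) := by
    rw [div_le_div_iff₀ (by linarith) (by positivity)]
    linarith
  calc _ ≤ 48 * (8 / c) ^ 4 / (a + b) * (4 / (c * (a + b))) := by gcongr
    _ = _ := by field_simp; ring

/-- The constant, depending on `p` alone, in the estimate of `ℙ(K < k)` for `k` near the median:
half of the constant in `abs_oddsIntegral_sub_le` plus the one in `abs_main_term_sub_le`. -/
noncomputable def medianConst (p : ℝ) : ℝ :=
  96 * (8 / (p * (1 - p) / 2)) ^ 4 / (p * (1 - p) / 2) + 44 / (p * (1 - p))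

theorem medianConst_pos (hp0 : 0 < p) (hp1 : p < 1) : 0 < medianConst p := by
  have hq : 0 < 1 - p := by linarith
  unfold medianConst
  positivity

/-- Half of the main term of the difference of the integrals, multiplied by `k = n p - ε`, is
`m - k` up to `O(1 / n)`, where `m` is the asserted median, `n = r + k` and `ε = r - n (1 - p)`. -/
theorem abs_main_term_sub_le (hp0 : 0 < p) (hp1 : p < 1) {n ε : ℝ} (hn : 8 ≤ n) (hε : |ε| ≤ 3) :
    |(n * p - ε) * (ε / (p * (1 - p) * (n - 2))
          - n * (2 * p - 1) / (3 * (p * (1 - p)) * ((n - 2) * (n - 4))))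
        + (-ε / (1 - p) - (1 / 2 - (1 + p) / (6 * (1 - p))))|
      ≤ 44 / (p * (1 - p)) / n := by
  have hq : 0 < 1 - p := by linarith
  have hn2 : 0 < n - 2 := by linarith
  have hn4 : 0 < n - 4 := by linarith
  obtain ⟨hε1, hε2⟩ := abs_le.1 hε
  have e : (n * p - ε) * (ε / (p * (1 - p) * (n - 2))
          - n * (2 * p - 1) / (3 * (p * (1 - p)) * ((n - 2) * (n - 4))))
        + (-ε / (1 - p) - (1 / 2 - (1 + p) / (6 * (1 - p))))
      = ε * (2 * p - ε) / (p * (1 - p) * (n - 2))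
        + (2 * p - 1) * (p * (8 - 6 * n) + ε * n) / (3 * (p * (1 - p)) * ((n - 2) * (n - 4))) := by
    field_simp
    ring
  have h1 : |ε * (2 * p - ε) / (p * (1 - p) * (n - 2))| ≤ 15 / (p * (1 - p) * (n / 2)) := by
    rw [abs_div, abs_mul, abs_of_pos (by positivity : 0 < p * (1 - p) * (n - 2))]
    have h5 : |2 * p - ε| ≤ 5 := by rw [abs_le]; constructor <;> linarith
    have : |ε| * |2 * p - ε| ≤ 3 * 5 := mul_le_mul hε h5 (abs_nonneg _) (by norm_num)
    apply div_le_div₀ (by norm_num) (by linarith) (by positivity)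
    gcongr
    linarith
  have h2 : |(2 * p - 1) * (p * (8 - 6 * n) + ε * n) / (3 * (p * (1 - p)) * ((n - 2) * (n - 4)))|
      ≤ 10 * n / (3 * (p * (1 - p)) * (n / 2 * (n / 2))) := by
    rw [abs_div, abs_mul, abs_of_pos (by positivity : 0 < 3 * (p * (1 - p)) * ((n - 2) * (n - 4)))]
    have h5 : |2 * p - 1| ≤ 1 := by rw [abs_le]; constructor <;> linarith
    have h6 : |p * (8 - 6 * n) + ε * n| ≤ 10 * n := by
      rw [abs_le]; constructor <;> nlinarith
    have : |2 * p - 1| * |p * (8 - 6 * n) + ε * n| ≤ 1 * (10 * n) :=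
      mul_le_mul h5 h6 (abs_nonneg _) (by norm_num)
    apply div_le_div₀ (by positivity) (by linarith) (by positivity)
    gcongr <;> linarith
  rw [e]
  refine (abs_add_le _ _).trans ((add_le_add h1 h2).trans ?_)
  have : 15 / (p * (1 - p) * (n / 2)) + 10 * n / (3 * (p * (1 - p)) * (n / 2 * (n / 2)))
      = (130 / 3) / (p * (1 - p)) / n := by
    field_simp
    ring
  rw [this]
  gcongr
  norm_num

/-- Near the asserted median `m`, `ℙ(K < k) - 1 / 2` is `P_{r,p}(k) (k - m)` up to a relative error
`O(1 / r)`. The size of `P_{r,p}(k)` itself plays no role. -/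
theorem abs_sum_negBinPMF_sub_half_le (hp0 : 0 < p) (hp1 : p < 1) {r : ℝ} (hr1 : 3 / p ≤ r)
    (hr2 : 40 / (p * (1 - p)) ≤ r) {k : ℕ}
    (hk : |k - (r * p / (1 - p) + (1 / 2 - (1 + p) / (6 * (1 - p))))| ≤ 2) :
    |∑ i ∈ Finset.range k, negBinPMF r p i - 1 / 2
        - negBinPMF r p k * (k - (r * p / (1 - p) + (1 / 2 - (1 + p) / (6 * (1 - p)))))|
      ≤ negBinPMF r p k * (medianConst p / r) := by
  have hq : 0 < 1 - p := by linarith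
  have hr0 : 0 < r := lt_of_lt_of_le (by positivity) hr1
  rw [div_le_iff₀ hp0] at hr1
  rw [div_le_iff₀ (by positivity)] at hr2
  have hsplit : (1 - p) * (k - (r * p / (1 - p) + (1 / 2 - (1 + p) / (6 * (1 - p)))))
      = -(r - (r + k) * (1 - p)) - ((1 - p) / 2 - (1 + p) / 6) := by
    field_simp
    ring
  obtain ⟨hk1, hk2⟩ := abs_le.1 hk
  have hk1' := mul_le_mul_of_nonneg_left hk1 hq.le
  have hk2' := mul_le_mul_of_nonneg_left hk2 hq.le
  rw [hsplit] at hk1' hk2'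
  -- `r - (r + k) (1 - p)` is `-(1 - p)` times the difference of `k` and the mean `r p / (1 - p)`.
  have he : |r - (r + k) * (1 - p)| ≤ 3 := by
    rw [abs_le]; constructor <;> linarith
  have hkpos : 0 < (k : ℝ) := by
    by_contra! h
    have : (k : ℝ) = 0 := le_antisymm h (Nat.cast_nonneg k)
    rw [this] at hk1'
    nlinarith
  have hk0 : 1 ≤ k := by exact_mod_cast hkpos
  have hn20 : 20 ≤ p * (1 - p) / 2 * (r + k) := by
    have : 0 ≤ p * (1 - p) / 2 * k := by positivity
    linarith
  have hn8 : 8 ≤ r + k := by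
    have : p * (1 - p) / 2 * (r + k) ≤ 1 * (r + k) := by
      apply mul_le_mul_of_nonneg_right _ (by positivity)
      nlinarith
    linarith
  have hE := abs_oddsIntegral_sub_le hp0 hp1 hr0 hkpos hn20 he
  have hM := abs_main_term_sub_le hp0 hp1 hn8 he
  have h1 := sum_range_negBinPMF hr0 hp0 hp1 k
  have h2 := one_sub_sum_range_negBinPMF hr0 hp0 hp1 hk0
  have hP := negBinPMF_pos hr0 hp0 hp1 k
  set ε := r - (r + k) * (1 - p) with hεd
  have hkn : (k : ℝ) = (r + k) * p - ε := by rw [hεd]; ring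
  have hkδ : (k - (r * p / (1 - p) + (1 / 2 - (1 + p) / (6 * (1 - p)))))
      = (-ε / (1 - p) - (1 / 2 - (1 + p) / (6 * (1 - p)))) := by
    rw [hεd]
    field_simp
    ring
  rw [hkδ]
  set D := (-ε / (1 - p) - (1 / 2 - (1 + p) / (6 * (1 - p))))
  rw [← hkn] at hM
  set I := ε / (p * (1 - p) * (r + k - 2))
    - (r + k) * (2 * p - 1) / (3 * (p * (1 - p)) * ((r + k - 2) * (r + k - 4)))
  set E := oddsIntegral p r k - oddsIntegral (1 - p) k r
  set Q := (8 / (p * (1 - p) / 2)) ^ 4 / (p * (1 - p) / 2) with hQ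
  have hQ0 : 0 < Q := by positivity
  have e : ∑ i ∈ Finset.range k, negBinPMF r p i - 1 / 2 - negBinPMF r p k * D
      = -(negBinPMF r p k * (k / 2 * (E - 2 * I) + (k * I + D))) := by
    linear_combination (1 / 2) * h1 - (1 / 2) * h2
  rw [e, abs_neg, abs_mul, abs_of_pos hP]
  refine mul_le_mul_of_nonneg_left ?_ hP.le
  have hE' : |k / 2 * (E - 2 * I)| ≤ 96 * Q / (r + k) := by
    rw [abs_mul, abs_of_pos (by positivity : 0 < (k : ℝ) / 2)]
    calc (k : ℝ) / 2 * |E - 2 * I| ≤ (r + k) / 2 * (192 * Q / (r + k) ^ 2) := by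
          rw [mul_div_assoc 192, ← hQ] at hE
          gcongr
          linarith
      _ = 96 * Q / (r + k) := by field_simp; norm_num
  calc _ ≤ 96 * Q / (r + k) + 44 / (p * (1 - p)) / (r + k) :=
        (abs_add_le _ _).trans (add_le_add hE' hM)
    _ = medianConst p / (r + k) := by
      rw [← add_div, hQ, ← mul_div_assoc]; rfl
    _ ≤ medianConst p / r := by
      have := (medianConst_pos hp0 hp1).le
      gcongr
      linarith

end Difference

/-! ### The distribution function of the smoothed variable and its median -/

section Median

open MeasureTheory ProbabilityTheory

theorem negBinMeasure_real_singleton {r p : ℝ} (hr : 0 < r) (hp0 : 0 < p) (hp1 : p < 1) (k : ℕ) :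
    (negBinMeasure r p).real {k} = negBinPMF r p k := by
  rw [measureReal_def, negBinMeasure, Measure.sum_smul_dirac_singleton,
    ENNReal.toReal_ofReal (negBinPMF_nonneg hr hp0 hp1 k)]

theorem negBinMeasure_real_Iio {r p : ℝ} (hr : 0 < r) (hp0 : 0 < p) (hp1 : p < 1) (k : ℕ) :
    (negBinMeasure r p).real (Set.Iio k) = ∑ i ∈ Finset.range k, negBinPMF r p i := by
  have := isProbabilityMeasure_negBinMeasure hr hp0 hp1
  rw [← Finset.coe_range, ← sum_measureReal_singleton]
  exact Finset.sum_congr rfl fun i _ => negBinMeasure_real_singleton hr hp0 hp1 i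

variable {Ω : Type*} [MeasurableSpace Ω] {P : Measure Ω}

theorem measureReal_le_of_isUniform_Ioo {U : Ω → ℝ} (hU : pdf.IsUniform U (Set.Ioo 0 1) P volume)
    {t : ℝ} (ht0 : 0 ≤ t) (ht1 : t ≤ 1) : P.real (U ⁻¹' Set.Iic t) = t := by
  rw [measureReal_def, hU.measure_preimage (by simp) (by simp) measurableSet_Iic]
  have h : volume (Set.Ioo (0 : ℝ) 1 ∩ Set.Iic t) = ENNReal.ofReal t := by
    rcases ht1.lt_or_eq with h | rfl
    · have : Set.Ioo (0 : ℝ) 1 ∩ Set.Iic t = Set.Ioc 0 t := by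
        ext x
        simp only [Set.mem_inter_iff, Set.mem_Ioo, Set.mem_Iic, Set.mem_Ioc]
        constructor
        · rintro ⟨⟨h1, _⟩, h2⟩; exact ⟨h1, h2⟩
        · rintro ⟨h1, h2⟩; exact ⟨⟨h1, h2.trans_lt h⟩, h2⟩
      rw [this, Real.volume_Ioc, sub_zero]
    · rw [Set.inter_eq_left.2 (Set.Ioo_subset_Ioc_self.trans Set.Ioc_subset_Iic_self),
        Real.volume_Ioo, sub_zero]
  simp [h, ht0]

theorem ae_mem_of_isUniform_Ioo {U : Ω → ℝ} (hU : pdf.IsUniform U (Set.Ioo 0 1) P volume) :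
    ∀ᵐ ω ∂P, U ω ∈ Set.Ioo (0 : ℝ) 1 := by
  rw [ae_iff]
  change P (U ⁻¹' (Set.Ioo (0 : ℝ) 1)ᶜ) = 0
  rw [hU.measure_preimage (by simp) (by simp) measurableSet_Ioo.compl]
  simp

variable [IsProbabilityMeasure P]

/-- The distribution function of `K + U` interpolates `k ↦ ℙ(K < k)` linearly. -/
theorem measureReal_add_le {r p : ℝ} (hr : 0 < r) (hp0 : 0 < p) (hp1 : p < 1)
    {K : Ω → ℕ} {U : Ω → ℝ} (hK : HasLaw K (negBinMeasure r p) P)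
    (hU : pdf.IsUniform U (Set.Ioo 0 1) P volume) (hKU : IndepFun K U P) {x : ℝ} {k : ℕ}
    (hk0 : (k : ℝ) ≤ x) (hk1 : x ≤ k + 1) :
    P.real {ω | (K ω : ℝ) + U ω ≤ x}
      = ∑ i ∈ Finset.range k, negBinPMF r p i + negBinPMF r p k * (x - k) := by
  have hUm : AEMeasurable U P := hU.aemeasurable (by simp) (by simp)
  have hae : {ω | (K ω : ℝ) + U ω ≤ x}
      =ᵐ[P] ((K ⁻¹' Set.Iio k) ∪ (K ⁻¹' {k} ∩ U ⁻¹' Set.Iic (x - k)) : Set Ω) := by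
    filter_upwards [ae_mem_of_isUniform_Ioo hU] with ω hω
    apply propext
    change (K ω : ℝ) + U ω ≤ x ↔ K ω < k ∨ (K ω = k ∧ U ω ≤ x - k)
    obtain ⟨h0, h1⟩ := hω
    rcases lt_trichotomy (K ω) k with h | h | h
    · have : (K ω : ℝ) + 1 ≤ k := by exact_mod_cast h
      simp only [h, true_or, iff_true]
      linarith
    · simp only [h, lt_irrefl, false_or, true_and]
      constructor <;> intro <;> linarith
    · have : (k : ℝ) + 1 ≤ K ω := by exact_mod_cast h
      simp only [h.not_gt, h.ne', false_and, or_false, iff_false]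
      linarith
  rw [measureReal_congr hae, measureReal_union₀]
  · congr 1
    · rw [← negBinMeasure_real_Iio hr hp0 hp1, ← hK.map_eq,
        map_measureReal_apply_of_aemeasurable hK.aemeasurable measurableSet_Iio]
    · rw [measureReal_def, hKU.measure_inter_preimage_eq_mul _ _ (measurableSet_singleton k)
        measurableSet_Iic, ENNReal.toReal_mul, ← measureReal_def, ← measureReal_def,
        measureReal_le_of_isUniform_Ioo hU (by linarith) (by linarith),
        ← negBinMeasure_real_singleton hr hp0 hp1, ← hK.map_eq,
        map_measureReal_apply_of_aemeasurable hK.aemeasurable (measurableSet_singleton k)]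
  · exact (hK.aemeasurable.nullMeasurable (measurableSet_singleton k)).inter
      (hUm.nullMeasurable measurableSet_Iic)
  · refine Disjoint.aedisjoint (Set.disjoint_left.2 fun ω h1 h2 => ?_)
    have h1 : K ω < k := h1
    have h2 : K ω = k := h2.1
    omega

theorem median_mem_Icc {X : Ω → ℝ} {l u : ℝ} (hl : P.real {ω | X ω ≤ l} < 1 / 2)
    (hu : 1 / 2 ≤ P.real {ω | X ω ≤ u}) : median P X ∈ Set.Icc l u := by
  have hb : ∀ x ∈ {x : ℝ | 1 / 2 ≤ P.real {ω | X ω ≤ x}}, l ≤ x := by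
    intro x hx
    by_contra! h
    have : P.real {ω | X ω ≤ x} ≤ P.real {ω | X ω ≤ l} :=
      measureReal_mono fun ω hω => le_trans hω h.le
    exact absurd (hx.trans this) (not_le.2 hl)
  exact ⟨le_csInf ⟨u, hu⟩ hb, csInf_le ⟨l, hb⟩ hu⟩

/-- The constant `c` is `P_{r,p}(⌊x⌋)`, the density of `K + U` at `x`. -/
theorem abs_measureReal_add_le_sub {r p : ℝ} (hp0 : 0 < p) (hp1 : p < 1)
    (hr1 : 3 / p ≤ r) (hr2 : 40 / (p * (1 - p)) ≤ r)
    {K : Ω → ℕ} {U : Ω → ℝ} (hK : HasLaw K (negBinMeasure r p) P)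
    (hU : pdf.IsUniform U (Set.Ioo 0 1) P volume) (hKU : IndepFun K U P) {x : ℝ}
    (hx : |x - (r * p / (1 - p) + (1 / 2 - (1 + p) / (6 * (1 - p))))| ≤ 1) :
    ∃ c : ℝ, 0 < c ∧ |P.real {ω | (K ω : ℝ) + U ω ≤ x} - 1 / 2
        - c * (x - (r * p / (1 - p) + (1 / 2 - (1 + p) / (6 * (1 - p)))))|
      ≤ c * (medianConst p / r) := by
  have hq : 0 < 1 - p := by linarith
  have hr0 : 0 < r := lt_of_lt_of_le (by positivity) hr1
  set m := r * p / (1 - p) + (1 / 2 - (1 + p) / (6 * (1 - p))) with hm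
  obtain ⟨hx1, hx2⟩ := abs_le.1 hx
  have hm1 : 1 ≤ m := by
    rw [div_le_iff₀ hp0] at hr1
    have e : m = (r * p + ((1 - p) / 2 - (1 + p) / 6)) / (1 - p) := by
      rw [hm]; field_simp
    rw [e, le_div_iff₀ hq]
    linarith
  have hx0 : 0 ≤ x := by linarith
  have hk0 := Nat.floor_le hx0
  have hk1 := (Nat.lt_floor_add_one x).le
  refine ⟨negBinPMF r p ⌊x⌋₊, negBinPMF_pos hr0 hp0 hp1 _, ?_⟩
  have h := abs_sum_negBinPMF_sub_half_le hp0 hp1 hr1 hr2 (k := ⌊x⌋₊)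
    (by rw [abs_le]; constructor <;> linarith)
  rw [measureReal_add_le hr0 hp0 hp1 hK hU hKU hk0 hk1]
  refine le_of_eq_of_le ?_ h
  congr 1
  ring

end Median

theorem mainTheorem2 (p : ℝ) (hp0 : 0 < p) (hp1 : p < 1) :
    ∃ C : ℝ, 0 < C ∧ ∀ᶠ r : ℝ in Filter.atTop,
      ∀ (Ω : Type*) [MeasurableSpace Ω] (P : MeasureTheory.Measure Ω)
        [MeasureTheory.IsProbabilityMeasure P] (K : Ω → ℕ) (U : Ω → ℝ),
        ProbabilityTheory.HasLaw K (negBinMeasure r p) P →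
        MeasureTheory.pdf.IsUniform U (Set.Ioo 0 1) P MeasureTheory.volume →
        ProbabilityTheory.IndepFun K U P →
        |(median P (fun ω => (K ω : ℝ) + U ω) - r * p / (1 - p))
            - (1 / 2 - (1 + p) / (6 * (1 - p)))| ≤ C * r⁻¹ := by
  have hB := medianConst_pos hp0 hp1
  refine ⟨2 * medianConst p, by positivity, ?_⟩
  filter_upwards [Filter.eventually_ge_atTop (3 / p),
    Filter.eventually_ge_atTop (40 / (p * (1 - p))),
    Filter.eventually_ge_atTop (2 * medianConst p)] with r hr1 hr2 hr3
  intro Ω _ P _ K U hK hU hKU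
  have hr0 : 0 < r := lt_of_lt_of_le (by positivity) hr3
  set m := r * p / (1 - p) + (1 / 2 - (1 + p) / (6 * (1 - p))) with hm
  have hd : 0 < medianConst p / r := by positivity
  have hd1 : 2 * (medianConst p / r) ≤ 1 := by
    rw [← mul_div_assoc, div_le_one hr0]; exact hr3
  -- The factor `2` on the lower side makes the inequality there strict.
  obtain ⟨c, hc, hl⟩ := abs_measureReal_add_le_sub hp0 hp1 hr1 hr2 hK hU hKU
    (x := m - 2 * (medianConst p / r)) (by rw [← hm, abs_le]; constructor <;> linarith)
  obtain ⟨c', hc', hu⟩ := abs_measureReal_add_le_sub hp0 hp1 hr1 hr2 hK hU hKU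
    (x := m + medianConst p / r) (by rw [← hm, abs_le]; constructor <;> linarith)
  rw [← hm] at hl hu
  have hcd := mul_pos hc hd
  have hmed := median_mem_Icc (P := P) (X := fun ω => (K ω : ℝ) + U ω)
    (l := m - 2 * (medianConst p / r)) (u := m + medianConst p / r)
    (by have := (abs_le.1 hl).2; linarith) (by have := (abs_le.1 hu).1; linarith)
  rw [sub_sub, ← hm, ← div_eq_mul_inv, mul_div_assoc, abs_le]
  constructor <;> linarith [hmed.1, hmed.2]
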